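/- Fix a finite alphabet $\Sigma$ and the value domain $\mathbb N\cup\{\infty\}$. A quantitative property is a map $p:\Sigma^\omega\to\mathbb N\cup\{\infty\}$, and a verdict function is a map $v:\Sigma^*\to\mathbb N\cup\{\infty\}$. For $f\in\Sigma^\omega$ let $\limsup v(f)$ and $\liminf v(f)$ be the limit superior and limit inferior of the values of $v$ on the prefixes of $f$ of length $0,1,2,\dots$ The verdict function $v$ is monotonically decreasing if $v(t)\le v(s)$ whenever $s$ is a prefix of $t$. It approximately monitors $p$ from below if $\limsup v(f)\le p(f)$ for all $f$, and from above if $p(f)\le\liminf v(f)$ for all $f$; it universally monitors $p$ if $\limsup v(f)=p(f)=\liminf v(f)$ for all $f$. With respect to monitoring from below, $v_1$ is more precise than $v_2$ if $\limsup v_2(f)\le\limsup v_1(f)$ for all $f$ with strict inequality for some $f$; with respect to monitoring from above, if $\liminf v_1(f)\le\liminf v_2(f)$ for all $f$ with strict inequality for some $f$. A $k$-counter machine is a deterministic machine with finitely many states and $k$ integer registers, all initially $0$. Each of its edges is labelled by a letter, a test (a boolean combination of comparisons $x\ge y$ of registers) and an update (a finite sequence of instructions $x\gets 0$ and $x\gets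 x+1$); for every state, letter and register valuation exactly one edge is enabled. To each state one of the outputs $0$, $\infty$, or the value of a fixed register is assigned. A $k$-counter verdict function is a verdict function $v$ such that, for some $k$-counter machine, $v(s)$ is the output of the machine after reading $s$, for every $s\in\Sigma^*$. Theorem. For every $k>1$ there exist a finite nonempty alphabet $\Sigma$ and a quantitative property $p_k:\Sigma^\omega\to\mathbb N\cup\{\infty\}$ such that $p_k$ is universally monitored by some monotonically decreasing $k$-counter verdict function. Moreover, for every $\ell<k$ and every monotonically decreasing $\ell$-counter verdict function $v_\ell$ that approximately monitors $p_k$ from below (resp. above), there exists a monotonically decreasing $(\ell+1)$-counter verdict function $v_{\ell+1}$ that approximately monitors $p_k$ from below (resp. above) and is more precise than $v_\ell$ with respect to monitoring from below (resp. above). -/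

import Mathlib

open Filter

universe u

/-! ### Quantitative properties and verdict functions -/

/-- A quantitative property over the alphabet `A`: a function from infinite traces to values. -/
abbrev QuantProperty (A : Type u) (D : Type*) := Stream' A → D

/-- A verdict function: a function from finite traces to values.  (The value domain is always a
complete lattice below, so suprema and infima of verdict values exist.) -/
abbrev Verdict (A : Type u) (D : Type*) := List A → D

namespace Verdict

variable {A : Type u} {D : Type*} [CompleteLattice D]

/-- The limit superior of the verdict sequence of `v` on the infinite trace `f`;
`f.take i` is the prefix of `f` of length `i`. -/
noncomputable def limSup (v : Verdict A D) (f : Stream' A) : D :=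
  limsup (fun i : ℕ => v (f.take i)) atTop

/-- The limit inferior of the verdict sequence of `v` on the infinite trace `f`. -/
noncomputable def limInf (v : Verdict A D) (f : Stream' A) : D :=
  liminf (fun i : ℕ => v (f.take i)) atTop

/-- `v` approximates `p` from below on every infinite trace. -/
def ApproxMonitorsFromBelow (v : Verdict A D) (p : QuantProperty A D) : Prop :=
  ∀ f : Stream' A, v.limSup f ≤ p f

/-- `v` approximates `p` from above on every infinite trace. -/
def ApproxMonitorsFromAbove (v : Verdict A D) (p : QuantProperty A D) : Prop :=
  ∀ f : Stream' A, p f ≤ v.limInf f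

/-- `v` universally monitors `p` from below. -/
def UnivMonitorsFromBelow (v : Verdict A D) (p : QuantProperty A D) : Prop :=
  ∀ f : Stream' A, v.limSup f = p f

/-- `v` universally monitors `p` from above. -/
def UnivMonitorsFromAbove (v : Verdict A D) (p : QuantProperty A D) : Prop :=
  ∀ f : Stream' A, p f = v.limInf f

/-- `v` is monotonically decreasing (with respect to the prefix order on finite traces). -/
def Decreasing (v : Verdict A D) : Prop :=
  ∀ s t : List A, s <+: t → v t ≤ v s

/-- `v₁` is (strictly) more precise than `v₂`, for monitoring from below. -/
def MorePreciseFromBelow (v₁ v₂ : Verdict A D) : Prop :=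
  (∀ f : Stream' A, v₂.limSup f ≤ v₁.limSup f) ∧ ∃ g : Stream' A, v₂.limSup g < v₁.limSup g

/-- `v₁` is (strictly) more precise than `v₂`, for monitoring from above. -/
def MorePreciseFromAbove (v₁ v₂ : Verdict A D) : Prop :=
  (∀ f : Stream' A, v₁.limInf f ≤ v₂.limInf f) ∧ ∃ g : Stream' A, v₁.limInf g < v₂.limInf g

end Verdict

/-! ### Register machines -/

/-- An edge `(q, σ, φ, γ, q')` of a register machine with registers `X`, states `Q` and
alphabet `A`: the test `φ` is a predicate on valuations `X → ℤ`, the update `γ` a function on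
valuations. -/
structure RegisterEdge (X Q : Type) (A : Type u) where
  source : Q
  letter : A
  test : (X → ℤ) → Prop
  update : (X → ℤ) → (X → ℤ)
  target : Q

/-- A deterministic register machine with registers `X`, alphabet `A` and output domain `D`. -/
structure RegisterMachine (X : Type) (A : Type u) (D : Type*) where
  /-- the states -/
  State : Type
  finite_state : Finite State
  /-- the set of edges -/
  edges : Set (RegisterEdge X State A)
  /-- the initial state -/
  init : State
  /-- the output function -/
  output : State → (X → ℤ) → D
  /-- in every situation exactly one edge is enabled -/
  deterministic : ∀ (q : State) (a : A) (ν : X → ℤ),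
    ∃! e : RegisterEdge X State A, e ∈ edges ∧ e.source = q ∧ e.letter = a ∧ e.test ν

namespace RegisterMachine

variable {X : Type} {A : Type u} {D : Type*}

/-- A configuration: a state together with a valuation of the registers. -/
abbrev Config (M : RegisterMachine X A D) := M.State × (X → ℤ)

/-- The initial configuration: all registers are `0`. -/
def initConfig (M : RegisterMachine X A D) : M.Config := (M.init, fun _ => 0)

/-- The transition relation between configurations. -/
def Step (M : RegisterMachine X A D) (c : M.Config) (a : A) (c' : M.Config) : Prop :=
  ∃ e ∈ M.edges, e.source = c.1 ∧ e.letter = a ∧ e.test c.2 ∧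
    e.target = c'.1 ∧ e.update c.2 = c'.2

/-- `M.Run c s c'`: reading the finite trace `s` leads from configuration `c` to `c'`. -/
def Run (M : RegisterMachine X A D) : M.Config → List A → M.Config → Prop
  | c, [], c' => c' = c
  | c, a :: s, c' => ∃ d : M.Config, M.Step c a d ∧ M.Run d s c'

/-- `M` generates the verdict function `v`. -/
def Generates (M : RegisterMachine X A D) (v : Verdict A D) : Prop :=
  ∀ s : List A, ∃ c : M.Config, M.Run M.initConfig s c ∧ M.output c.1 c.2 = v s

end RegisterMachine

/-! ### Counter machines -/

/-- The tests described by the instructions `x ≥ y`: boolean combinations of comparisons of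
registers. -/
inductive IsCounterTest {X : Type} : ((X → ℤ) → Prop) → Prop
  | true : IsCounterTest (fun _ => True)
  | ge (x y : X) : IsCounterTest (fun ν => ν x ≥ ν y)
  | not {φ : (X → ℤ) → Prop} : IsCounterTest φ → IsCounterTest (fun ν => ¬ φ ν)
  | and {φ ψ : (X → ℤ) → Prop} :
      IsCounterTest φ → IsCounterTest ψ → IsCounterTest (fun ν => φ ν ∧ ψ ν)

/-- The updates described by the instructions `x ← 0` and `x ← x + 1`: finite (possibly empty)
sequences of these instructions, executed one after the other. -/
inductive IsCounterUpdate {X : Type} [DecidableEq X] : ((X → ℤ) → (X → ℤ)) → Prop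
  | skip : IsCounterUpdate (fun ν => ν)
  | reset (x : X) {γ : (X → ℤ) → (X → ℤ)} :
      IsCounterUpdate γ → IsCounterUpdate (fun ν => Function.update (γ ν) x 0)
  | incr (x : X) {γ : (X → ℤ) → (X → ℤ)} :
      IsCounterUpdate γ → IsCounterUpdate (fun ν => Function.update (γ ν) x (γ ν x + 1))

/-- The output functions of counter machines: in every state the output is `0`, `∞`, or the value
of one fixed register.  (Register values of a counter machine are never negative along a run, so
`Int.toNat` is the identity on the values that are output.) -/
def IsCounterOutput {X Q : Type} (out : Q → (X → ℤ) → ℕ∞) : Prop :=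
  ∀ q : Q, (∀ ν, out q ν = 0) ∨ (∀ ν, out q ν = ⊤) ∨
    ∃ x : X, ∀ ν, out q ν = (((ν x).toNat : ℕ) : ℕ∞)

/-- A counter machine: a register machine with values in `ℕ ∪ {∞}` whose tests, updates and output
function are those of a counter machine.  Up to equivalence there are only finitely many tests over
a finite set of registers, so by determinism only finitely many edges of a counter machine can
ever be enabled. -/
def RegisterMachine.IsCounterMachine {X : Type} [DecidableEq X] {A : Type u}
    (M : RegisterMachine X A ℕ∞) : Prop :=
  (∀ e ∈ M.edges, IsCounterTest e.test ∧ IsCounterUpdate e.update) ∧ IsCounterOutput M.output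

/-- `v` is a `k`-counter verdict function. -/
def IsCounterVerdict {A : Type u} (k : ℕ) (v : Verdict A ℕ∞) : Prop :=
  ∃ M : RegisterMachine (Fin k) A ℕ∞, M.IsCounterMachine ∧ M.Generates v

/-!
The property separating the counter hierarchy is a delayed question about counts.  Over the alphabet
`Fin k ⊕ Fin k` the letter `inl i` is an event of kind `i` and the letter `inr i` asks for the
number of events of kind `i` seen so far.  A trace is mapped to the answer to its first question,
and to `∞` if there is none.  A machine with `k` counters, one for each kind, outputs `∞` until the question
comes and the right counter from then on (`isCounterVerdict_queryVerdict`).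

Fewer than `k` counters do not suffice, by counting configurations.  Tests only see the order of the
registers, so finitely many updates occur, and after `n` letters every register is at most `C * n`
(`RegisterMachine.IsCounterMachine.exists_run_bound`).  Hence the number of configurations reachable
while reading `b ^ k` words with different counts below `b` is `O (b ^ l)`, where `l < k` is the
number of registers.  Two of these words lead to the same configuration, the verdicts on their
extensions by the same question have the same limit, and this limit is wrong for one of them
(`exists_limSup_ne`).

The value of the property is fixed as soon as a question has been asked.  So a verdict function with
`l < k` counters that approximates the property has a wrong limit on some trace extending a word `u`
all of whose extensions have one and the same finite value `N`.  One more register, loaded with the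
constant `N`, suffices to output `N` on the extensions of `u`.  The output is `∞` on the proper
prefixes of `u`, which keeps the verdict function decreasing, and it is unchanged elsewhere
(`Verdict.patch`).  The limits are then exact on the extensions of `u` and the old ones on all other
traces, whether the approximation is from below or from above.
-/

/-! ### Limits of verdict functions -/

namespace Verdict

variable {A : Type u}

theorem Decreasing.antitone_take {v : Verdict A ℕ∞} (hv : v.Decreasing) (f : Stream' A) :
    Antitone fun i : ℕ => v (f.take i) := by
  refine antitone_nat_of_succ_le fun i => hv _ _ ?_
  rw [Stream'.take_succ']
  exact List.prefix_append _ _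

theorem Decreasing.limInf_eq_limSup {v : Verdict A ℕ∞} (hv : v.Decreasing) (f : Stream' A) :
    v.limInf f = v.limSup f :=
  have h := tendsto_atTop_iInf (hv.antitone_take f)
  h.liminf_eq.trans h.limsup_eq.symm

theorem take_length_add_append_stream (u : List A) (f : Stream' A) (j : ℕ) :
    (u ++ₛ f).take (u.length + j) = u ++ f.take j := by
  induction u with
  | nil => simp
  | cons a u ih =>
    rw [List.length_cons, Nat.add_right_comm, Stream'.cons_append_stream,
      Stream'.take_succ_cons, ih, List.cons_append]

theorem limSup_append_stream (v : Verdict A ℕ∞) (u : List A) (f : Stream' A) :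
    v.limSup (u ++ₛ f) = limsup (fun j : ℕ => v (u ++ f.take j)) atTop := by
  rw [limSup, ← limsup_nat_add _ u.length]
  simp only [add_comm _ u.length, take_length_add_append_stream]

theorem limSup_eq_of_forall_append {v : Verdict A ℕ∞} {u : List A} {N : ℕ∞}
    (h : ∀ t, v (u ++ t) = N) {f : Stream' A} (hf : f.take u.length = u) : v.limSup f = N := by
  rw [← Stream'.append_take_drop u.length f, hf, limSup_append_stream]
  simp [h]

open Classical in
/-- The verdict function `v`, overwritten by the value `N` on all extensions of `u` and by `∞` on
all proper prefixes of `u`. -/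
noncomputable def patch (v : Verdict A ℕ∞) (u : List A) (N : ℕ) : Verdict A ℕ∞ := fun s =>
  if u <+: s then N else if s <+: u then ⊤ else v s

theorem Decreasing.patch {v : Verdict A ℕ∞} (hv : v.Decreasing) (u : List A) (N : ℕ) :
    (v.patch u N).Decreasing := by
  intro s t hst
  by_cases hs : u <+: s
  · simp [Verdict.patch, hs, hs.trans hst]
  by_cases hs' : s <+: u
  · simp [Verdict.patch, hs, hs']
  have ht : ¬ u <+: t := fun h =>
    (List.prefix_or_prefix_of_prefix hst h).elim hs' hs
  have ht' : ¬ t <+: u := fun h => hs' (hst.trans h)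
  simpa [Verdict.patch, hs, hs', ht, ht'] using hv s t hst

theorem limSup_patch_of_take_eq (v : Verdict A ℕ∞) {u : List A} (N : ℕ) {f : Stream' A}
    (hf : f.take u.length = u) : (v.patch u N).limSup f = N :=
  limSup_eq_of_forall_append (fun t => if_pos (List.prefix_append u t)) hf

theorem limSup_patch_of_take_ne (v : Verdict A ℕ∞) {u : List A} (N : ℕ) {f : Stream' A}
    (hf : f.take u.length ≠ u) : (v.patch u N).limSup f = v.limSup f := by
  refine limsup_congr ?_
  filter_upwards [eventually_ge_atTop u.length] with j hj
  have h₁ : ¬ u <+: f.take j := by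
    intro h
    apply hf
    rw [List.prefix_iff_eq_take, Stream'.take_take, min_eq_right hj] at h
    exact h.symm
  have h₂ : ¬ f.take j <+: u := by
    intro h
    have := h.eq_of_length_le (by simpa using hj)
    exact h₁ (this ▸ List.prefix_rfl)
  simp [patch, h₁, h₂]

end Verdict

/-! ### Runs of register machines -/

namespace RegisterMachine

variable {X : Type} {A : Type u} {D : Type*} {M : RegisterMachine X A D}

theorem Step.unique {c d d' : M.Config} {a : A} (h : M.Step c a d) (h' : M.Step c a d') :
    d = d' := by
  obtain ⟨e, he, hs, hl, ht, hq, hu⟩ := h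
  obtain ⟨e', he', hs', hl', ht', hq', hu'⟩ := h'
  obtain rfl : e = e' :=
    (M.deterministic c.1 a c.2).unique ⟨he, hs, hl, ht⟩ ⟨he', hs', hl', ht'⟩
  exact Prod.ext (hq.symm.trans hq') (hu.symm.trans hu')

theorem Run.unique {s : List A} {c d d' : M.Config} (h : M.Run c s d) (h' : M.Run c s d') :
    d = d' := by
  induction s generalizing c with
  | nil => exact Eq.trans h (Eq.symm h')
  | cons a s ih =>
    obtain ⟨e, he, h⟩ := h
    obtain ⟨e', he', h'⟩ := h'
    obtain rfl := he.unique he'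
    exact ih h h'

theorem run_append {s t : List A} {c d : M.Config} :
    M.Run c (s ++ t) d ↔ ∃ e, M.Run c s e ∧ M.Run e t d := by
  induction s generalizing c with
  | nil => simp [Run]
  | cons a s ih =>
    simp only [List.cons_append, Run, ih]
    constructor
    · rintro ⟨e, he, e', h₁, h₂⟩
      exact ⟨e', ⟨e, he, h₁⟩, h₂⟩
    · rintro ⟨e', ⟨e, he, h₁⟩, h₂⟩
      exact ⟨e, he, e', h₁, h₂⟩

/-- Two words leading to the same configuration cannot be told apart later on. -/
theorem Generates.append_eq_append {v : Verdict A D} (hv : M.Generates v) {s s' : List A}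
    {c : M.Config} (h : M.Run M.initConfig s c) (h' : M.Run M.initConfig s' c) (t : List A) :
    v (s ++ t) = v (s' ++ t) := by
  obtain ⟨d, hd, hvd⟩ := hv (s ++ t)
  obtain ⟨d', hd', hvd'⟩ := hv (s' ++ t)
  obtain ⟨e, he, hed⟩ := run_append.1 hd
  obtain ⟨e', he', hed'⟩ := run_append.1 hd'
  obtain rfl := he.unique h
  obtain rfl := he'.unique h'
  obtain rfl := hed.unique hed'
  exact hvd.symm.trans hvd'

end RegisterMachine

/-! ### Growth of counters -/

theorem IsCounterTest.congr {X : Type} {φ : (X → ℤ) → Prop} (h : IsCounterTest φ)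
    {ν μ : X → ℤ} (hνμ : ∀ x y, ν x ≥ ν y ↔ μ x ≥ μ y) : φ ν ↔ φ μ := by
  induction h with
  | true => rfl
  | ge x y => exact hνμ x y
  | not _ ih => exact not_congr ih
  | and _ _ ih₁ ih₂ => exact and_congr ih₁ ih₂

/-- All values of the valuation lie between `0` and `B`. -/
def RegistersWithin {X : Type} (B : ℕ) (ν : X → ℤ) : Prop :=
  ∀ x, 0 ≤ ν x ∧ ν x ≤ B

theorem RegistersWithin.mono {X : Type} {B B' : ℕ} {ν : X → ℤ} (h : RegistersWithin B ν)
    (hB : B ≤ B') : RegistersWithin B' ν :=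
  fun x => ⟨(h x).1, (h x).2.trans (by exact_mod_cast hB)⟩

theorem IsCounterUpdate.exists_bound {X : Type} [DecidableEq X] {γ : (X → ℤ) → (X → ℤ)}
    (h : IsCounterUpdate γ) :
    ∃ C : ℕ, ∀ ν B, RegistersWithin B ν → RegistersWithin (B + C) (γ ν) := by
  induction h with
  | skip => exact ⟨0, fun ν B h => h⟩
  | reset x _ ih =>
    obtain ⟨C, hC⟩ := ih
    refine ⟨C, fun ν B h y => ?_⟩
    have := hC ν B h y
    rcases eq_or_ne y x with rfl | hy
    · simp; positivity
    · simpa [hy] using this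
  | incr x _ ih =>
    obtain ⟨C, hC⟩ := ih
    refine ⟨C + 1, fun ν B h y => ?_⟩
    have := hC ν B h y
    rcases eq_or_ne y x with rfl | hy
    · simp only [Function.update_self]; push_cast at this ⊢; omega
    · simp only [Function.update_of_ne hy]; push_cast at this ⊢; omega

namespace RegisterMachine

variable {X : Type} [DecidableEq X] {A : Type u} {M : RegisterMachine X A ℕ∞}

/-- There is one bound on the growth of the registers in all steps, although the set of edges may
be infinite: the edge taken depends only on the state, the letter and the order of the registers. -/
theorem IsCounterMachine.exists_step_bound [Finite X] [Finite A] (hM : M.IsCounterMachine) :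
    ∃ C : ℕ, ∀ c a d B, M.Step c a d → RegistersWithin B c.2 → RegistersWithin (B + C) d.2 := by
  have := M.finite_state
  have key : ∀ T : M.State × A × (X → X → Prop), ∃ C : ℕ, ∀ ν : X → ℤ,
      (∀ x y, ν x ≥ ν y ↔ T.2.2 x y) → ∀ e ∈ M.edges, e.source = T.1 → e.letter = T.2.1 →
        e.test ν → ∀ B, RegistersWithin B ν → RegistersWithin (B + C) (e.update ν) := by
    rintro ⟨q, a, τ⟩
    by_cases h : ∃ ν : X → ℤ, ∀ x y, ν x ≥ ν y ↔ τ x y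
    · obtain ⟨ν₀, hν₀⟩ := h
      obtain ⟨e₀, he₀, huniq⟩ := M.deterministic q a ν₀
      obtain ⟨C, hC⟩ := (hM.1 e₀ he₀.1).2.exists_bound
      refine ⟨C, fun ν hν e he hs hl ht B hB => ?_⟩
      have ht' : e.test ν₀ :=
        ((hM.1 e he).1.congr fun x y => (hν x y).trans (hν₀ x y).symm).1 ht
      rw [huniq e ⟨he, hs, hl, ht'⟩]
      exact hC ν B hB
    · exact ⟨0, fun ν hν => (h ⟨ν, hν⟩).elim⟩
  choose C hC using key
  obtain ⟨K, hK⟩ := (Set.finite_range C).bddAbove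
  refine ⟨K, ?_⟩
  rintro c a d B ⟨e, he, hs, hl, ht, -, hu⟩ hB
  rw [← hu]
  refine (hC (c.1, a, fun x y => c.2 x ≥ c.2 y) c.2 (fun _ _ => Iff.rfl) e he hs hl ht B hB).mono ?_
  exact Nat.add_le_add_left (hK ⟨_, rfl⟩) B

theorem IsCounterMachine.exists_run_bound [Finite X] [Finite A] (hM : M.IsCounterMachine) :
    ∃ C : ℕ, ∀ s c, M.Run M.initConfig s c → RegistersWithin (C * s.length) c.2 := by
  obtain ⟨C, hC⟩ := hM.exists_step_bound
  refine ⟨C, fun s c h => ?_⟩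
  induction s using List.reverseRecOn generalizing c with
  | nil =>
    obtain rfl : c = M.initConfig := h
    intro x
    simp [initConfig]
  | append_singleton s a ih =>
    obtain ⟨d, hd, e, hde, rfl⟩ := run_append.1 h
    rw [List.length_append, List.length_singleton, mul_add, mul_one]
    exact hC _ _ _ _ hde (ih d hd)

end RegisterMachine

/-! ### Overwriting a verdict function by means of one more counter -/

theorem IsCounterTest.comp_init {n : ℕ} {φ : (Fin n → ℤ) → Prop} (h : IsCounterTest φ) :
    IsCounterTest fun ν : Fin (n + 1) → ℤ => φ (Fin.init ν) := by
  induction h with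
  | true => exact .true
  | ge x y => exact .ge x.castSucc y.castSucc
  | not _ ih => exact .not ih
  | and _ _ ih₁ ih₂ => exact .and ih₁ ih₂

theorem IsCounterUpdate.snoc_last {n : ℕ} {γ : (Fin n → ℤ) → (Fin n → ℤ)}
    (h : IsCounterUpdate γ) :
    IsCounterUpdate fun ν : Fin (n + 1) → ℤ =>
      (Fin.snoc (γ (Fin.init ν)) (ν (Fin.last n)) : Fin (n + 1) → ℤ) := by
  induction h with
  | skip => simpa only [Fin.snoc_init_self] using IsCounterUpdate.skip
  | reset x _ ih => simpa only [Fin.snoc_update] using ih.reset x.castSucc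
  | incr x _ ih =>
    simpa only [Fin.snoc_update, Fin.snoc_castSucc] using ih.incr x.castSucc

theorem IsCounterUpdate.snoc_const {n : ℕ} {γ : (Fin n → ℤ) → (Fin n → ℤ)}
    (h : IsCounterUpdate γ) (N : ℕ) :
    IsCounterUpdate fun ν : Fin (n + 1) → ℤ =>
      (Fin.snoc (γ (Fin.init ν)) (N : ℤ) : Fin (n + 1) → ℤ) := by
  induction N with
  | zero => simpa only [Fin.update_snoc_last, Nat.cast_zero] using h.snoc_last.reset (Fin.last n)
  | succ N ih =>
    simpa only [Fin.update_snoc_last, Fin.snoc_last, Nat.cast_succ] using ih.incr (Fin.last n)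

namespace RegisterMachine

variable {A : Type} {n : ℕ}

/-- The edge of `M.patch u N` above the edge `e`, for the remembered prefix `m`. -/
def patchEdge {Q : Type} (N L : ℕ) (e : RegisterEdge (Fin n) Q A)
    (m : {m : List A // m.length ≤ L}) :
    RegisterEdge (Fin (n + 1)) (Q × {m : List A // m.length ≤ L}) A where
  source := (e.source, m)
  letter := e.letter
  test ν := e.test (Fin.init ν)
  update ν := Fin.snoc (e.update (Fin.init ν)) (N : ℤ)
  target := (e.target, ⟨(m.1 ++ [e.letter]).take L, List.length_take_le _ _⟩)

open Classical in
/-- The machine `M` with one more register, which holds `N` after the first letter, and with the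
prefix of length at most `u.length` of the input remembered in the state, which suffices to
recognize the prefixes and the extensions of `u`. -/
noncomputable def patch [Finite A] (M : RegisterMachine (Fin n) A ℕ∞) (u : List A) (N : ℕ) :
    RegisterMachine (Fin (n + 1)) A ℕ∞ where
  State := M.State × {m : List A // m.length ≤ u.length}
  finite_state :=
    have := M.finite_state
    have : Finite {m : List A // m.length ≤ u.length} := List.finite_length_le A u.length
    inferInstance
  edges := {e' | ∃ e ∈ M.edges, ∃ m, e' = patchEdge N u.length e m}
  init := (M.init, ⟨[], Nat.zero_le _⟩)
  output q ν :=
    if u = q.2.1 then ((ν (Fin.last n)).toNat : ℕ)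
    else if q.2.1 <+: u then ⊤ else M.output q.1 (Fin.init ν)
  deterministic := by
    rintro ⟨q, m⟩ a ν
    obtain ⟨e, ⟨he, hs, hl, ht⟩, huniq⟩ := M.deterministic q a (Fin.init ν)
    refine ⟨patchEdge N u.length e m, ⟨⟨e, he, m, rfl⟩, Prod.ext hs rfl, hl, ht⟩, ?_⟩
    rintro _ ⟨⟨e', he', m', rfl⟩, hs', hl', ht'⟩
    obtain ⟨hs', rfl⟩ := Prod.ext_iff.1 hs'
    rw [huniq e' ⟨he', hs', hl', ht'⟩]
    rfl

variable [Finite A] {M : RegisterMachine (Fin n) A ℕ∞}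

theorem IsCounterMachine.patch (hM : M.IsCounterMachine) (u : List A) (N : ℕ) :
    (M.patch u N).IsCounterMachine := by
  constructor
  · rintro _ ⟨e, he, m, rfl⟩
    exact ⟨(hM.1 e he).1.comp_init, (hM.1 e he).2.snoc_const N⟩
  · rintro ⟨q, m⟩
    by_cases h₁ : u = m.1
    · exact .inr (.inr ⟨Fin.last n, fun ν => if_pos h₁⟩)
    by_cases h₂ : m.1 <+: u
    · exact .inr (.inl fun ν => (if_neg h₁).trans (if_pos h₂))
    have h (ν) : (M.patch u N).output (q, m) ν = M.output q (Fin.init ν) :=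
      (if_neg h₁).trans (if_neg h₂)
    simp only [h]
    rcases hM.2 q with hq | hq | ⟨x, hq⟩
    · exact .inl fun ν => hq _
    · exact .inr (.inl fun ν => hq _)
    · exact .inr (.inr ⟨x.castSucc, fun ν => hq _⟩)

/-- A run of `M` lifts to `M.patch u N`; the new register holds `N` from the first step on. -/
theorem Run.patch {u : List A} {N : ℕ} {s : List A} {c d : M.Config} (h : M.Run c s d)
    (m : {m : List A // m.length ≤ u.length}) (z : ℤ) :
    (M.patch u N).Run ((c.1, m), Fin.snoc c.2 z) s
      ((d.1, ⟨(m.1 ++ s).take u.length, List.length_take_le _ _⟩),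
        Fin.snoc d.2 (if s = [] then z else N)) := by
  induction s generalizing c m z with
  | nil =>
    obtain rfl : d = c := h
    simp [Run, List.take_of_length_le m.2]
  | cons a s ih =>
    obtain ⟨c', ⟨e, he, hs, hl, ht, hq, hu⟩, hd⟩ := h
    refine ⟨((c'.1, ⟨(m.1 ++ [a]).take u.length, List.length_take_le _ _⟩), Fin.snoc c'.2 (N : ℤ)),
      ⟨patchEdge N u.length e m, ⟨e, he, m, rfl⟩, Prod.ext hs rfl, hl, ?_, ?_, ?_⟩, ?_⟩
    · simpa [patchEdge] using ht
    · exact Prod.ext hq (Subtype.ext (by simp [patchEdge, hl]))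
    · simp [patchEdge, hu]
    · have := ih hd ⟨(m.1 ++ [a]).take u.length, List.length_take_le _ _⟩ N
      have hm : ((m.1 ++ [a]).take u.length ++ s).take u.length =
          (m.1 ++ a :: s).take u.length := by
        rw [List.append_cons m.1 a s, List.take_append (l₂ := s), List.take_append (l₂ := s),
          List.take_take, min_self, List.length_take]
        congr 2
        omega
      simpa [hm] using this

theorem Generates.patch {v : Verdict A ℕ∞} (hv : M.Generates v) {u : List A} (hu : u ≠ [])
    (N : ℕ) : (M.patch u N).Generates (v.patch u N) := by
  intro s
  obtain ⟨c, hc, hcv⟩ := hv s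
  have hinit : (M.patch u N).initConfig =
      ((M.init, ⟨[], Nat.zero_le _⟩), Fin.snoc (fun _ => (0 : ℤ)) (0 : ℤ)) :=
    Prod.ext rfl (funext fun i => by
      induction i using Fin.lastCases <;> simp [initConfig])
  refine ⟨_, hinit ▸ hc.patch ⟨[], Nat.zero_le _⟩ 0, ?_⟩
  simp only [RegisterMachine.patch, Verdict.patch, List.nil_append, Fin.init_snoc,
    Fin.snoc_last, hcv]
  by_cases h₁ : u = s.take u.length
  -- the new register holds `N` only once a letter has been read, which is why `u` is not empty
  · have hs : s ≠ [] := fun hs => hu (by simpa [hs] using h₁)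
    rw [if_pos h₁, if_pos (List.prefix_iff_eq_take.2 h₁)]
    simp [hs]
  rw [if_neg h₁, if_neg fun h => h₁ (List.prefix_iff_eq_take.1 h)]
  -- a word of length at least `u.length` is remembered as a word of length `u.length`
  have h₂ : s.take u.length <+: u ↔ s <+: u := by
    refine ⟨fun h => ?_, (List.take_prefix _ _).trans⟩
    rcases le_total s.length u.length with hs | hs
    · rwa [List.take_of_length_le hs] at h
    · exact (h₁ (h.eq_of_length (by simpa using hs)).symm).elim
  by_cases h₃ : s <+: u
  · rw [if_pos (h₂.2 h₃), if_pos h₃]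
  · rw [if_neg (h₂.not.2 h₃), if_neg h₃]

end RegisterMachine

theorem IsCounterVerdict.patch {A : Type} [Finite A] {n : ℕ} {v : Verdict A ℕ∞}
    (hv : IsCounterVerdict n v) {u : List A} (hu : u ≠ []) (N : ℕ) :
    IsCounterVerdict (n + 1) (v.patch u N) :=
  let ⟨M, hM, hMv⟩ := hv
  ⟨M.patch u N, hM.patch u N, hMv.patch hu N⟩

/-! ### Counting events up to the first question -/

/-- The answer to the first question in a word over `Fin k ⊕ Fin k`, or `∞` if there is none: the
letter `inl i` is an event of kind `i`, the letter `inr i` asks for the number of events of kind `i`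
so far.  The events before the beginning of the word are counted by `n`. -/
def queryVerdictFrom {k : ℕ} : (Fin k → ℕ) → Verdict (Fin k ⊕ Fin k) ℕ∞
  | _, [] => ⊤
  | n, .inl i :: s => queryVerdictFrom (Function.update n i (n i + 1)) s
  | n, .inr i :: _ => n i

/-- The answer to the first question in a word, or `∞` if there is none. -/
def queryVerdict (k : ℕ) : Verdict (Fin k ⊕ Fin k) ℕ∞ :=
  queryVerdictFrom 0

/-- The answer to the first question in a trace, or `∞` if there is none: the limit of the
answers on its prefixes, which are eventually constant. -/
noncomputable def queryProperty (k : ℕ) : QuantProperty (Fin k ⊕ Fin k) ℕ∞ :=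
  (queryVerdict k).limSup

variable {k : ℕ}

theorem decreasing_queryVerdictFrom (n : Fin k → ℕ) : (queryVerdictFrom n).Decreasing := by
  rintro s _ ⟨t, rfl⟩
  induction s generalizing n with
  | nil => exact le_top
  | cons a s ih =>
    cases a with
    | inl i => exact ih _
    | inr i => exact le_rfl

theorem queryVerdictFrom_append (n : Fin k → ℕ) (w : List (Fin k)) (i : Fin k)
    (t : List (Fin k ⊕ Fin k)) :
    queryVerdictFrom n (w.map .inl ++ .inr i :: t) = (n i + w.count i : ℕ) := by
  induction w generalizing n with
  | nil => simp [queryVerdictFrom]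
  | cons j w ih =>
    rw [List.map_cons, List.cons_append, queryVerdictFrom, ih]
    rcases eq_or_ne i j with rfl | h
    · simp [add_comm, add_left_comm]
    · simp [h, h.symm]

/-- The machine generating `queryVerdict k`: in the state `none` it counts events, in the state
`some i` it outputs the number of events of kind `i`. -/
def queryMachine (k : ℕ) : RegisterMachine (Fin k) (Fin k ⊕ Fin k) ℕ∞ where
  State := Option (Fin k)
  finite_state := inferInstance
  edges := {e | e.test = (fun _ => True) ∧
    match e.source, e.letter with
    | none, .inl i => e.update = (fun ν => Function.update ν i (ν i + 1)) ∧ e.target = none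
    | none, .inr i => e.update = (fun ν => ν) ∧ e.target = some i
    | some i, _ => e.update = (fun ν => ν) ∧ e.target = some i}
  init := none
  output
    | none, _ => ⊤
    | some i, ν => ((ν i).toNat : ℕ)
  deterministic := by
    rintro (_ | i) (j | j) ν
    · exact ⟨⟨none, .inl j, fun _ => True, fun ν => Function.update ν j (ν j + 1), none⟩,
        by simp, by rintro ⟨_, _, _, _, _⟩; simp; grind⟩
    · exact ⟨⟨none, .inr j, fun _ => True, fun ν => ν, some j⟩,
        by simp, by rintro ⟨_, _, _, _, _⟩; simp; grind⟩
    · exact ⟨⟨some i, .inl j, fun _ => True, fun ν => ν, some i⟩,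
        by simp, by rintro ⟨_, _, _, _, _⟩; simp; grind⟩
    · exact ⟨⟨some i, .inr j, fun _ => True, fun ν => ν, some i⟩,
        by simp, by rintro ⟨_, _, _, _, _⟩; simp; grind⟩

theorem isCounterMachine_queryMachine (k : ℕ) : (queryMachine k).IsCounterMachine := by
  constructor
  · rintro ⟨_ | i, j | j, φ, γ, q⟩ ⟨h₁, h₂, h₃⟩ <;> dsimp only at h₁ h₂ <;> subst h₁ h₂
    · exact ⟨.true, .incr j .skip⟩
    all_goals exact ⟨.true, .skip⟩
  · rintro (_ | i)
    · exact .inr (.inl fun _ => rfl)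
    · exact .inr (.inr ⟨i, fun _ => rfl⟩)

theorem queryMachine_run_some (i : Fin k) (ν : Fin k → ℤ) (s : List (Fin k ⊕ Fin k)) :
    (queryMachine k).Run (some i, ν) s (some i, ν) := by
  induction s with
  | nil => rfl
  | cons a s ih =>
    exact ⟨_, ⟨⟨some i, a, fun _ => True, fun ν => ν, some i⟩, ⟨rfl, rfl, rfl⟩, rfl, rfl, trivial,
      rfl, rfl⟩, ih⟩

theorem exists_queryMachine_run (n : Fin k → ℕ) (s : List (Fin k ⊕ Fin k)) :
    ∃ c, (queryMachine k).Run (none, fun i => (n i : ℤ)) s c ∧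
      (queryMachine k).output c.1 c.2 = queryVerdictFrom n s := by
  induction s generalizing n with
  | nil => exact ⟨_, rfl, rfl⟩
  | cons a s ih =>
    rcases a with i | i
    · obtain ⟨c, hc, hv⟩ := ih (Function.update n i (n i + 1))
      refine ⟨c, ⟨_, ⟨⟨none, .inl i, fun _ => True, fun ν => Function.update ν i (ν i + 1), none⟩,
        ⟨rfl, rfl, rfl⟩, rfl, rfl, trivial, rfl, funext fun j => ?_⟩, hc⟩, hv⟩
      rcases eq_or_ne j i with rfl | h <;> simp [*]
    · exact ⟨_, ⟨_, ⟨⟨none, .inr i, fun _ => True, fun ν => ν, some i⟩,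
        ⟨rfl, rfl, rfl⟩, rfl, rfl, trivial, rfl, rfl⟩, queryMachine_run_some i _ s⟩, by
          simp [queryMachine, queryVerdictFrom]⟩

theorem isCounterVerdict_queryVerdict (k : ℕ) : IsCounterVerdict k (queryVerdict k) :=
  ⟨queryMachine k, isCounterMachine_queryMachine k, fun s => exists_queryMachine_run 0 s⟩

/-! ### Insufficiency of fewer than `k` counters, and the hierarchy -/

theorem exists_word_of_count (n : Fin k → ℕ) :
    ∃ w : List (Fin k), (∀ i, w.count i = n i) ∧ w.length = ∑ i, n i := by
  refine ⟨(∑ i, Multiset.replicate (n i) i).toList, fun i => ?_, ?_⟩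
  · rw [← Multiset.coe_count, Multiset.coe_toList, Multiset.count_sum']
    simp [Multiset.count_replicate]
  · simp

/-- With fewer than `k` counters, there are words with different counts that lead to the same
configuration: the number of configurations grows too slowly for all vectors of `k` counts. -/
theorem exists_words_same_config {l : ℕ} (hl : l < k)
    {M : RegisterMachine (Fin l) (Fin k ⊕ Fin k) ℕ∞} (hM : M.IsCounterMachine)
    (hrun : ∀ s, ∃ c, M.Run M.initConfig s c) :
    ∃ (w w' : List (Fin k)) (i : Fin k) (c : M.Config), w.count i ≠ w'.count i ∧
      M.Run M.initConfig (w.map .inl) c ∧ M.Run M.initConfig (w'.map .inl) c := by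
  classical
  obtain ⟨C, hC⟩ := hM.exists_run_bound
  have := M.finite_state
  have := Fintype.ofFinite M.State
  -- `b` counts of each kind: `b ^ k` words, but only `O (b ^ l)` configurations
  set b := Fintype.card M.State * (C * k + 1) ^ l + 1 with hb
  choose word hcount hlen using exists_word_of_count (k := k)
  choose conf hconf using hrun
  let F (n : Fin k → Fin b) : M.Config := conf ((word fun i => n i).map .inl)
  have hF (n) : RegistersWithin (C * k * b) (F n).2 := by
    refine (hC _ _ (hconf _)).mono ?_
    rw [List.length_map, hlen, mul_assoc]
    refine Nat.mul_le_mul_left C ?_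
    calc ∑ i, (n i : ℕ) ≤ ∑ _i : Fin k, b := Finset.sum_le_sum fun i _ => (n i).2.le
      _ = k * b := by simp
  let G (n : Fin k → Fin b) : M.State × (Fin l → Fin (C * k * b + 1)) :=
    ((F n).1, fun x => ⟨((F n).2 x).toNat, by have := hF n x; omega⟩)
  have hcard : Fintype.card (M.State × (Fin l → Fin (C * k * b + 1))) <
      Fintype.card (Fin k → Fin b) := by
    simp only [Fintype.card_prod, Fintype.card_fun, Fintype.card_fin]
    calc Fintype.card M.State * (C * k * b + 1) ^ l
        ≤ Fintype.card M.State * ((C * k + 1) * b) ^ l := by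
          gcongr
          rw [add_mul, one_mul]
          omega
      _ = (Fintype.card M.State * (C * k + 1) ^ l) * b ^ l := by rw [mul_pow, mul_assoc]
      _ < b * b ^ l := Nat.mul_lt_mul_of_pos_right (by omega) (Nat.pow_pos (by omega))
      _ = b ^ (l + 1) := by rw [pow_succ']
      _ ≤ b ^ k := Nat.pow_le_pow_right (by omega) hl
  obtain ⟨n, n', hne, hG⟩ := Fintype.exists_ne_map_eq_of_card_lt G hcard
  obtain ⟨i, hi⟩ := Function.ne_iff.1 hne
  have hFF : F n = F n' := by
    obtain ⟨h₁, h₂⟩ := Prod.ext_iff.1 hG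
    refine Prod.ext h₁ (funext fun x => ?_)
    have h := congrArg Fin.val (congrFun h₂ x)
    have := hF n x
    have := hF n' x
    dsimp only [G] at h
    omega
  refine ⟨word fun i => n i, word fun i => n' i, i, F n, ?_, hconf _, hFF ▸ hconf _⟩
  rw [hcount, hcount]
  exact fun h => hi (Fin.ext h)

/-- A verdict function with fewer than `k` counters has a wrong limit on some trace extending a word
`u` that forces the finite value `N` of the property. -/
theorem exists_limSup_ne {l : ℕ} (hl : l < k) {v : Verdict (Fin k ⊕ Fin k) ℕ∞}
    (hv : IsCounterVerdict l v) :
    ∃ (u : List (Fin k ⊕ Fin k)) (N : ℕ), u ≠ [] ∧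
      (∀ f : Stream' _, f.take u.length = u → queryProperty k f = N) ∧
      ∃ g : Stream' _, g.take u.length = u ∧ v.limSup g ≠ N := by
  obtain ⟨M, hM, hMv⟩ := hv
  obtain ⟨w, w', i, c, hi, hw, hw'⟩ := exists_words_same_config hl hM
    fun s => (hMv s).imp fun _ => And.left
  by_contra! H
  have key (w : List (Fin k)) :
      v.limSup ((w.map .inl ++ [.inr i]) ++ₛ Stream'.const (.inr i)) = (w.count i : ℕ) := by
    refine H (w.map .inl ++ [.inr i]) (w.count i) (by simp) (fun f hf => ?_) _ ?_
    · refine Verdict.limSup_eq_of_forall_append (fun t => ?_) hf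
      rw [List.append_assoc, queryVerdict, List.singleton_append, queryVerdictFrom_append]
      simp
    · exact (Verdict.take_length_add_append_stream _ _ 0).trans (List.append_nil _)
  have h := (key w).symm.trans (Eq.trans ?_ (key w'))
  · exact hi (by exact_mod_cast h)
  · simp only [Verdict.limSup_append_stream, List.append_assoc, hMv.append_eq_append hw hw']

theorem mainTheorem8 (k : ℕ) (hk : 1 < k) :
    ∃ (A : Type) (_ : Finite A) (_ : Nonempty A) (p : QuantProperty A ℕ∞),
      (∃ v : Verdict A ℕ∞, IsCounterVerdict k v ∧ v.Decreasing ∧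
        v.UnivMonitorsFromBelow p ∧ v.UnivMonitorsFromAbove p) ∧
      (∀ l : ℕ, l < k → ∀ v : Verdict A ℕ∞, IsCounterVerdict l v → v.Decreasing →
        v.ApproxMonitorsFromBelow p →
        ∃ w : Verdict A ℕ∞, IsCounterVerdict (l + 1) w ∧ w.Decreasing ∧
          w.ApproxMonitorsFromBelow p ∧ w.MorePreciseFromBelow v) ∧
      (∀ l : ℕ, l < k → ∀ v : Verdict A ℕ∞, IsCounterVerdict l v → v.Decreasing →
        v.ApproxMonitorsFromAbove p →
        ∃ w : Verdict A ℕ∞, IsCounterVerdict (l + 1) w ∧ w.Decreasing ∧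
          w.ApproxMonitorsFromAbove p ∧ w.MorePreciseFromAbove v) := by
  have hdec : (queryVerdict k).Decreasing := decreasing_queryVerdictFrom 0
  refine ⟨Fin k ⊕ Fin k, inferInstance, ⟨.inl ⟨0, by omega⟩⟩, queryProperty k,
    ⟨queryVerdict k, isCounterVerdict_queryVerdict k, hdec, fun f => rfl,
      fun f => (hdec.limInf_eq_limSup f).symm⟩, ?_, ?_⟩
  all_goals
    intro l hl v hv hvd hvp
    obtain ⟨u, N, hu, hN, g, hg, hgN⟩ := exists_limSup_ne hl hv
    refine ⟨v.patch u N, hv.patch hu N, hvd.patch u N, ?_⟩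
  · have hle (f) : v.limSup f ≤ (v.patch u N).limSup f ∧
        (v.patch u N).limSup f ≤ queryProperty k f := by
      by_cases hf : f.take u.length = u
      · rw [Verdict.limSup_patch_of_take_eq v N hf, hN f hf]
        exact ⟨hN f hf ▸ hvp f, le_rfl⟩
      · rw [Verdict.limSup_patch_of_take_ne v N hf]
        exact ⟨le_rfl, hvp f⟩
    refine ⟨fun f => (hle f).2, fun f => (hle f).1, g, lt_of_le_of_ne (hle g).1 ?_⟩
    rwa [Verdict.limSup_patch_of_take_eq v N hg]
  · simp only [Verdict.ApproxMonitorsFromAbove, Verdict.MorePreciseFromAbove,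
      hvd.limInf_eq_limSup, (hvd.patch u N).limInf_eq_limSup] at hvp ⊢
    have hle (f) : (v.patch u N).limSup f ≤ v.limSup f ∧
        queryProperty k f ≤ (v.patch u N).limSup f := by
      by_cases hf : f.take u.length = u
      · rw [Verdict.limSup_patch_of_take_eq v N hf, hN f hf]
        exact ⟨hN f hf ▸ hvp f, le_rfl⟩
      · rw [Verdict.limSup_patch_of_take_ne v N hf]
        exact ⟨le_rfl, hvp f⟩
    refine ⟨fun f => (hle f).2, fun f => (hle f).1, g, lt_of_le_of_ne (hle g).1 ?_⟩
    rw [Verdict.limSup_patch_of_take_eq v N hg]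
    exact hgN.symm
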